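/- Let $\mathcal H$ and $\mathcal G$ be real Hilbert spaces, let $A\colon\mathcal H\to 2^{\mathcal H}$ and $B\colon\mathcal G\to 2^{\mathcal G}$ be maximally monotone operators, and let $L\colon\mathcal H\to\mathcal G$ be a bounded linear operator with adjoint $L^*$. Let $\mathscr P=\{x\in\mathcal H : 0\in Ax+L^*BLx\}$ be the set of primal solutions, let $\mathscr D=\{v^*\in\mathcal G : 0\in -LA^{-1}(-L^*v^*)+B^{-1}v^*\}$ be the set of dual solutions, and let $$\boldsymbol Z=\{(x,v^*)\in\mathcal H\oplus\mathcal G : -L^*v^*\in Ax\ \text{ and }\ Lx\in B^{-1}v^*\}$$ be the Kuhn–Tucker set. For a set-valued operator $C$, write $J_C=(\mathrm{Id}+C)^{-1}$ for its resolvent. Suppose that $\mathscr P\neq\varnothing$, let $\varepsilon\in\,]0,1[$, let $x_0\in\mathcal H$ and $v_0^*\in\mathcal G$, and let $\gamma_n,\mu_n\in[\varepsilon,1/\varepsilon]$ and $\lambda_n\in[\varepsilon,2-\varepsilon]$ for every $n\in\mathbb N$. For $n=0,1,\ldots$ iterate $$a_n=J_{\gamma_nA}(x_n-\gamma_nL^*v_n^*),\qquad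 l_n=Lx_n,\qquad b_n=J_{\mu_nB}(l_n+\mu_nv_n^*),$$ $$s_n^*=\gamma_n^{-1}(x_n-a_n)+\mu_n^{-1}L^*(l_n-b_n),\qquad t_n=b_n-La_n,\qquad \tau_n=\|s_n^*\|^2+\|t_n\|^2;$$ if $\tau_n=0$, terminate at $\overline x=a_n$, $\overline v^*=v_n^*+\mu_n^{-1}(l_n-b_n)$; if $\tau_n>0$, set $$\theta_n=\lambda_n\bigl(\gamma_n^{-1}\|x_n-a_n\|^2+\mu_n^{-1}\|l_n-b_n\|^2\bigr)/\tau_n,\qquad x_{n+1}=x_n-\theta_ns_n^*,\qquad v_{n+1}^*=v_n^*-\theta_nt_n.$$ Then this algorithm is well defined (all the resolvents that occur are single-valued at the points where they are evaluated), and either it terminates after finitely many iterations at a point $(\overline x,\overline v^*)\in\boldsymbol Z$, or it generates infinite sequences such that the following hold: 1. $\sum_{n}\|s_n^*\|^2<+\infty$ and $\sum_{n}\|t_n\|^2<+\infty$. 2. $\sum_{n}\|x_{n+1}-x_n\|^2<+\infty$ and $\sum_{n}\|v_{n+1}^*-v_n^*\|^2<+\infty$. 3. $\sum_{n}\|x_n-a_n\|^2<+\infty$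 and $\sum_{n}\|Lx_n-b_n\|^2<+\infty$. 4. $(x_n)_{n\in\mathbb N}$ converges weakly to a point $\overline x\in\mathscr P$, $(v_n^*)_{n\in\mathbb N}$ converges weakly to a point $\overline v^*\in\mathscr D$, and $(\overline x,\overline v^*)\in\boldsymbol Z$. -/

import Mathlib

open Filter Topology
open scoped Pointwise

namespace MonoOp

section Operators

variable {E : Type*}

/-- The graph of a set-valued operator. -/
def graph (A : E → Set E) : Set (E × E) := {p | p.2 ∈ A p.1}

/-- The inverse of a set-valued operator. -/
def inverse (A : E → Set E) : E → Set E := fun u => {x | u ∈ A x}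

/-- The (set-valued) resolvent `J_A = (Id + A)⁻¹`. -/
def resolvent [Add E] (A : E → Set E) : E → Set E := inverse (fun x => {x} + A x)

variable [NormedAddCommGroup E] [InnerProductSpace ℝ E]

/-- Monotonicity of a set-valued operator on a real inner product space. -/
def IsMonotone (A : E → Set E) : Prop :=
  ∀ p ∈ graph A, ∀ q ∈ graph A, 0 ≤ inner ℝ (p.1 - q.1) (p.2 - q.2)

/-- Maximal monotonicity: no monotone operator has a strictly larger graph. -/
def IsMaximallyMonotone (A : E → Set E) : Prop :=
  IsMonotone A ∧ ¬ ∃ B : E → Set E, IsMonotone B ∧ graph A ⊆ graph B ∧ graph B ≠ graph A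

end Operators

section Problem

variable {H G : Type*} [NormedAddCommGroup H] [InnerProductSpace ℝ H] [CompleteSpace H]
  [NormedAddCommGroup G] [InnerProductSpace ℝ G] [CompleteSpace G]

/-- The solutions of the primal inclusion `0 ∈ A x + L* B L x`. -/
def primalSolutions (A : H → Set H) (B : G → Set G) (L : H →L[ℝ] G) : Set H :=
  {x | (0 : H) ∈ A x + (ContinuousLinearMap.adjoint L) '' B (L x)}

/-- The solutions of the dual inclusion `0 ∈ -L A⁻¹(-L* v) + B⁻¹ v`. -/
def dualSolutions (A : H → Set H) (B : G → Set G) (L : H →L[ℝ] G) : Set G :=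
  {v | (0 : G) ∈ -(L '' inverse A (-(ContinuousLinearMap.adjoint L v))) + inverse B v}

/-- The Kuhn-Tucker set: pairs `(x, v)` with `-L* v ∈ A x` and `L x ∈ B⁻¹ v`. -/
def kuhnTucker (A : H → Set H) (B : G → Set G) (L : H →L[ℝ] G) : Set (H × G) :=
  {z | -(ContinuousLinearMap.adjoint L z.2) ∈ A z.1 ∧ L z.1 ∈ inverse B z.2}

end Problem

section Algorithm

/-- The sequences that occur in the algorithm. -/
structure Iterates (H G : Type*) where
  x : ℕ → H
  v : ℕ → G
  a : ℕ → H
  l : ℕ → G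
  b : ℕ → G
  s : ℕ → H
  t : ℕ → G
  τ : ℕ → ℝ
  θ : ℕ → ℝ

/-- Iteration `n` is executed, i.e. the algorithm has not terminated at an earlier iteration. -/
def Iterates.Reaches {H G : Type*} (T : Iterates H G) (n : ℕ) : Prop := ∀ k < n, T.τ k ≠ 0

variable {H G : Type*} [NormedAddCommGroup H] [InnerProductSpace ℝ H] [CompleteSpace H]
  [NormedAddCommGroup G] [InnerProductSpace ℝ G] [CompleteSpace G]

/-- `T` is a run of the algorithm with parameters `γ`, `μ`, `lam`, started at `(x₀, v₀)`.
Only the iterations that are executed are constrained: once some `τ n = 0`, the algorithm has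
terminated and later entries of `T` have no meaning. A point `a` is the value of a resolvent at `y`
when the value of the set-valued resolvent at `y` is the singleton `{a}`. -/
structure IsRun (A : H → Set H) (B : G → Set G) (L : H →L[ℝ] G) (γ μ lam : ℕ → ℝ)
    (x₀ : H) (v₀ : G) (T : Iterates H G) : Prop where
  init_x : T.x 0 = x₀
  init_v : T.v 0 = v₀
  a_eq : ∀ n, T.Reaches n →
    resolvent (γ n • A) (T.x n - γ n • ContinuousLinearMap.adjoint L (T.v n)) = {T.a n}
  l_eq : ∀ n, T.Reaches n → T.l n = L (T.x n)
  b_eq : ∀ n, T.Reaches n → resolvent (μ n • B) (T.l n + μ n • T.v n) = {T.b n}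
  s_eq : ∀ n, T.Reaches n → T.s n =
    (γ n)⁻¹ • (T.x n - T.a n) + (μ n)⁻¹ • ContinuousLinearMap.adjoint L (T.l n - T.b n)
  t_eq : ∀ n, T.Reaches n → T.t n = T.b n - L (T.a n)
  τ_eq : ∀ n, T.Reaches n → T.τ n = ‖T.s n‖ ^ 2 + ‖T.t n‖ ^ 2
  θ_eq : ∀ n, T.Reaches n → 0 < T.τ n → T.θ n =
    lam n * ((γ n)⁻¹ * ‖T.x n - T.a n‖ ^ 2 + (μ n)⁻¹ * ‖T.l n - T.b n‖ ^ 2) / T.τ n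
  x_succ : ∀ n, T.Reaches n → 0 < T.τ n → T.x (n + 1) = T.x n - T.θ n • T.s n
  v_succ : ∀ n, T.Reaches n → 0 < T.τ n → T.v (n + 1) = T.v n - T.θ n • T.t n

end Algorithm

end MonoOp

/-!
Each iteration is a relaxed projection in the Hilbert direct sum of `H` and `G`. Monotonicity of `A`
and `B`, tested at the graph points produced by the two resolvents, puts the Kuhn–Tucker set in the
half-space
`⟪xₙ - x, sₙ⟫ + ⟪vₙ - v, tₙ⟫ ≥ γₙ⁻¹ ‖xₙ - aₙ‖² + μₙ⁻¹ ‖L xₙ - bₙ‖² =: gapₙ`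
(`le_inner_sub_of_mem_kuhnTucker`), and the next iterate is the projection onto it, relaxed by
`lam n`. Hence the iterates are Fejér monotone with respect to the Kuhn–Tucker set, which is nonempty
because there is a primal solution, and `∑ gapₙ² / τₙ` is finite (`IsInfiniteRun.fejer`). As
`τₙ ≤ C gapₙ` (`norm_sq_add_norm_sq_le`), the sums of `gapₙ` and of `τₙ` are finite. The
summability claims follow from these three.

Weak convergence follows from Opial's lemma (`exists_weak_limit_of_fejer`), once weak cluster points
are known to be Kuhn–Tucker points. As `sₙ` and `tₙ` tend to zero, this is the demiclosedness
statement `mem_kuhnTucker_of_tendsto`. Cluster points are taken along ultrafilters, so that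
Banach–Alaoglu applies without separability.

That the resolvents are single-valued everywhere is Minty's theorem
(`IsMaximallyMonotone.exists_resolvent_eq_singleton`). It is derived from an intersection property of
balls, the one-point extension of nonexpansive maps (`exists_forall_norm_sub_le`). For finite
families that property is obtained by maximising a concave quadratic function on a simplex, and for
arbitrary ones by weak compactness.
-/

/-! ### Extension of nonexpansive maps by one point -/

/-- Twice the variance of a weighted family of points is its mean squared mutual distance. -/
theorem sum_mul_sum_mul_norm_sub_sq {ι E : Type*} [NormedAddCommGroup E] [InnerProductSpace ℝ E]
    [Fintype ι] (w : ι → ℝ) (hw : ∑ i, w i = 1) (p : ι → E) :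
    ∑ i, ∑ j, w i * w j * ‖p i - p j‖ ^ 2
      = 2 * (∑ i, w i * ‖p i‖ ^ 2 - ‖∑ i, w i • p i‖ ^ 2) := by
  have h1 : ∀ i j, w i * w j * ‖p i - p j‖ ^ 2
      = w i * ‖p i‖ ^ 2 * w j + w i * (w j * ‖p j‖ ^ 2)
        - 2 * inner ℝ (w i • p i) (w j • p j) := by
    intro i j
    rw [norm_sub_sq_real, real_inner_smul_left, real_inner_smul_right]
    ring
  simp_rw [h1, Finset.sum_sub_distrib, Finset.sum_add_distrib, ← Finset.mul_sum,
    ← Finset.sum_mul, ← inner_sum, ← sum_inner, hw, real_inner_self_eq_norm_sq]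
  ring

/-- Kirszbraun's one-point extension for finite families: if `q i ↦ p i` is nonexpansive, it extends
to a nonexpansive map defined at `0`, with value `x`. By duality, `x` is the barycentre
`∑ w i • p i` for weights `w` maximising the concave function
`∑ w i (‖p i‖² - ‖q i‖²) - ‖∑ w i • p i‖² = min_x ∑ w i (‖x - p i‖² - ‖q i‖²)` on the simplex. -/
theorem exists_forall_norm_sub_le_of_fintype {ι E : Type*} [NormedAddCommGroup E]
    [InnerProductSpace ℝ E] [Fintype ι] (p q : ι → E)
    (h : ∀ i j, ‖p i - p j‖ ≤ ‖q i - q j‖) : ∃ x, ∀ i, ‖x - p i‖ ≤ ‖q i‖ := by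
  classical
  rcases isEmpty_or_nonempty ι with hι | hι
  · exact ⟨0, fun i => hι.elim i⟩
  let c : ι → ℝ := fun i => ‖p i‖ ^ 2 - ‖q i‖ ^ 2
  let g : (ι → ℝ) → ℝ := fun w => ∑ i, w i * c i - ‖∑ i, w i • p i‖ ^ 2
  have hg : Continuous g := by fun_prop
  obtain ⟨w, hw, hmax⟩ := (isCompact_stdSimplex ℝ ι).exists_isMaxOn
    ⟨_, single_mem_stdSimplex ℝ hι.some⟩ hg.continuousOn
  set x := ∑ i, w i • p i with hx
  -- the variance identity turns the nonexpansiveness into `g w ≤ -‖∑ w i • q i‖²`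
  have hg0 : g w ≤ 0 := by
    have hp := sum_mul_sum_mul_norm_sub_sq w hw.2 p
    have hq := sum_mul_sum_mul_norm_sub_sq w hw.2 q
    have hle : ∑ i, ∑ j, w i * w j * ‖p i - p j‖ ^ 2
        ≤ ∑ i, ∑ j, w i * w j * ‖q i - q j‖ ^ 2 := by
      gcongr with i _ j _
      · exact mul_nonneg (hw.1 i) (hw.1 j)
      · exact h i j
    have hgw : g w = ∑ i, w i * ‖p i‖ ^ 2 - ∑ i, w i * ‖q i‖ ^ 2 - ‖x‖ ^ 2 := by
      simp only [g, c, mul_sub, Finset.sum_sub_distrib, hx]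
    nlinarith [sq_nonneg ‖∑ i, w i • q i‖]
  refine ⟨x, fun j => ?_⟩
  set S := ∑ i, w i * c i with hS
  have hgx : g w = S - ‖x‖ ^ 2 := rfl
  -- first-order optimality of `w` in the direction of the vertex `j`
  have hopt : c j - S - 2 * inner ℝ x (p j - x) ≤ 0 := by
    have key : ∀ t : ℝ, 0 < t → t ≤ 1 →
        c j - S - 2 * inner ℝ x (p j - x) ≤ t * ‖p j - x‖ ^ 2 := by
      intro t ht ht1
      set w' : ι → ℝ := (1 - t) • w + t • Pi.single j (1 : ℝ) with hw'
      have hmem : w' ∈ stdSimplex ℝ ι :=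
        convex_stdSimplex ℝ ι hw (single_mem_stdSimplex ℝ j) (by linarith) ht.le (by ring)
      have hle : g (w') ≤ g w := hmax hmem
      have e1 : ∑ i, w' i * c i
          = (1 - t) * S + t * c j := by
        simp [hw', add_mul, Finset.sum_add_distrib, mul_assoc, ← Finset.mul_sum, hS, Pi.single_apply]
      have e2 : ∑ i, w' i • p i
          = x + t • (p j - x) := by
        have : ∑ i, w' i • p i
            = (1 - t) • x + t • p j := by
          simp [hw', add_smul, Finset.sum_add_distrib, mul_smul, ← Finset.smul_sum, hx,
            Pi.single_apply]
        rw [this]; module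
      have e3 : ‖x + t • (p j - x)‖ ^ 2
          = ‖x‖ ^ 2 + 2 * (t * inner ℝ x (p j - x)) + t ^ 2 * ‖p j - x‖ ^ 2 := by
        rw [norm_add_sq_real, real_inner_smul_right, norm_smul, mul_pow, Real.norm_eq_abs, sq_abs]
      have e4 : g w'
          = (1 - t) * S + t * c j - ‖x + t • (p j - x)‖ ^ 2 := by
        simp only [g]; rw [e1, e2]
      rw [e4, e3, hgx] at hle
      have : t * (c j - S - 2 * inner ℝ x (p j - x)) ≤ t * (t * ‖p j - x‖ ^ 2) := by nlinarith
      exact le_of_mul_le_mul_left this ht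
    have hlim : Tendsto (fun t : ℝ => t * ‖p j - x‖ ^ 2) (𝓝[>] 0) (𝓝 0) := by
      have : Tendsto (fun t : ℝ => t * ‖p j - x‖ ^ 2) (𝓝 0) (𝓝 (0 * ‖p j - x‖ ^ 2)) :=
        tendsto_id.mul_const _
      rw [zero_mul] at this
      exact this.mono_left nhdsWithin_le_nhds
    refine ge_of_tendsto hlim ?_
    filter_upwards [Ioc_mem_nhdsGT (zero_lt_one' ℝ)] with t ht using key t ht.1 ht.2
  rw [inner_sub_right, real_inner_self_eq_norm_sq] at hopt
  have hn := norm_sub_sq_real x (p j)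
  refine le_of_sq_le_sq ?_ (norm_nonneg _)
  simp only [c] at hopt
  linarith

/-! ### Weak limits -/

/-- Weak compactness of balls of a Hilbert space, in terms of ultrafilters: no separability is needed to
extract weak limits in this way. -/
theorem Ultrafilter.exists_weak_limit {ι E : Type*} [NormedAddCommGroup E] [InnerProductSpace ℝ E]
    [CompleteSpace E] (U : Ultrafilter ι) (f : ι → E) (C : ℝ) (hf : ∀ᶠ i in U, ‖f i‖ ≤ C) :
    ∃ x, ∀ y, Tendsto (fun i => inner ℝ (f i) y) U (𝓝 (inner ℝ x y)) := by
  let F : ι → WeakDual ℝ E := fun i => StrongDual.toWeakDual (InnerProductSpace.toDual ℝ E (f i))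
  have hK := WeakDual.isCompact_closedBall (𝕜 := ℝ) (0 : StrongDual ℝ E) C
  have hmem : ∀ᶠ i in U,
      F i ∈ WeakDual.toStrongDual ⁻¹' Metric.closedBall (0 : StrongDual ℝ E) C := by
    filter_upwards [hf] with i hi
    simpa [F] using hi
  obtain ⟨φ, -, hφ⟩ := hK.ultrafilter_le_nhds (U.map F) (Filter.le_principal_iff.2 hmem)
  refine ⟨(InnerProductSpace.toDual ℝ E).symm (WeakDual.toStrongDual φ), fun y => ?_⟩
  have h1 : Tendsto F U (𝓝 φ) := hφ
  have h2 := ((WeakDual.eval_continuous (𝕜 := ℝ) y).tendsto φ).comp h1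
  simpa [F, Function.comp_def] using h2

theorem norm_le_of_weak_limit {ι E : Type*} [NormedAddCommGroup E] [InnerProductSpace ℝ E]
    {l : Filter ι} [l.NeBot] {f : ι → E} {x : E} {C : ℝ}
    (hx : ∀ y, Tendsto (fun i => inner ℝ (f i) y) l (𝓝 (inner ℝ x y)))
    (hC : ∀ᶠ i in l, ‖f i‖ ≤ C) : ‖x‖ ≤ C := by
  have h1 : inner ℝ x x ≤ C * ‖x‖ := by
    refine le_of_tendsto (hx x) ?_
    filter_upwards [hC] with i hi
    exact (real_inner_le_norm _ _).trans (by gcongr)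
  rw [real_inner_self_eq_norm_mul_norm] at h1
  rcases (norm_nonneg x).eq_or_lt with h0 | h0
  · obtain ⟨i, hi⟩ := hC.exists
    exact h0 ▸ (norm_nonneg _).trans hi
  · exact le_of_mul_le_mul_right h1 h0

/-- Kirszbraun's one-point extension for arbitrary families in a Hilbert space: a weak limit of the
solutions for the finite subfamilies solves the whole system. -/
theorem exists_forall_norm_sub_le {ι E : Type*} [NormedAddCommGroup E]
    [InnerProductSpace ℝ E] [CompleteSpace E] (p q : ι → E)
    (h : ∀ i j, ‖p i - p j‖ ≤ ‖q i - q j‖) : ∃ x, ∀ i, ‖x - p i‖ ≤ ‖q i‖ := by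
  classical
  rcases isEmpty_or_nonempty ι with hι | ⟨⟨i₀⟩⟩
  · exact ⟨0, fun i => hι.elim i⟩
  have hfin : ∀ s : Finset ι, ∃ x, ∀ i ∈ s, ‖x - p i‖ ≤ ‖q i‖ := by
    intro s
    obtain ⟨x, hx⟩ := exists_forall_norm_sub_le_of_fintype (fun i : s => p i) (fun i : s => q i)
      (fun i j => h i j)
    exact ⟨x, fun i hi => hx ⟨i, hi⟩⟩
  choose f hf using hfin
  let U : Ultrafilter (Finset ι) := Ultrafilter.of atTop
  have hU : ∀ i, ∀ᶠ s in (U : Filter (Finset ι)), ‖f s - p i‖ ≤ ‖q i‖ := by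
    intro i
    have : ∀ᶠ s : Finset ι in atTop, ‖f s - p i‖ ≤ ‖q i‖ := by
      filter_upwards [eventually_ge_atTop {i}] with s hs
      exact hf s i (hs (Finset.mem_singleton_self i))
    exact (Ultrafilter.of_le atTop) this
  obtain ⟨x, hx⟩ := U.exists_weak_limit f (‖q i₀‖ + ‖p i₀‖) (by
    filter_upwards [hU i₀] with s hs
    calc ‖f s‖ = ‖(f s - p i₀) + p i₀‖ := by rw [sub_add_cancel]
      _ ≤ ‖f s - p i₀‖ + ‖p i₀‖ := norm_add_le _ _
      _ ≤ _ := by gcongr)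
  refine ⟨x, fun i => norm_le_of_weak_limit (l := U) (f := fun s => f s - p i) (fun y => ?_) (hU i)⟩
  simp only [inner_sub_left]
  exact (hx y).sub tendsto_const_nhds

/-! ### Resolvents of maximally monotone operators -/

namespace MonoOp

/-- A point monotonically related to the whole graph of a maximally monotone operator lies on the
graph. -/
theorem IsMaximallyMonotone.mem_of_forall {E : Type*} [NormedAddCommGroup E]
    [InnerProductSpace ℝ E] {A : E → Set E} (hA : IsMaximallyMonotone A) {x u : E}
    (h : ∀ a, ∀ w ∈ A a, 0 ≤ inner ℝ (x - a) (u - w)) : u ∈ A x := by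
  by_contra hu
  refine hA.2 ⟨fun y => {w | w ∈ A y ∨ (y = x ∧ w = u)}, ?_, fun p hp => Or.inl hp, fun heq => ?_⟩
  · rintro ⟨p, p'⟩ (hp | ⟨hp, hp'⟩) ⟨q, q'⟩ (hq | ⟨hq, hq'⟩)
    · exact hA.1 _ hp _ hq
    · dsimp only at hq hq' ⊢
      subst hq hq'
      rw [← neg_sub, ← neg_sub q', inner_neg_neg]
      exact h _ _ hp
    · dsimp only at hp hp' ⊢
      subst hp hp'
      exact h _ _ hq
    · dsimp only at hp hp' hq hq' ⊢
      subst hp hp' hq hq'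
      simp
  · have : (x, u) ∈ graph A := heq ▸ Or.inr ⟨rfl, rfl⟩
    exact hu this

theorem mem_resolvent_smul {E : Type*} [NormedAddCommGroup E] [InnerProductSpace ℝ E]
    {A : E → Set E} {γ : ℝ} (hγ : 0 < γ) {y a : E} :
    a ∈ resolvent (γ • A) y ↔ γ⁻¹ • (y - a) ∈ A a := by
  change y ∈ {a} + γ • A a ↔ _
  rw [Set.singleton_add, Set.image_add_left, Set.mem_preimage,
    Set.mem_smul_set_iff_inv_smul_mem₀ hγ.ne', neg_add_eq_sub]

/-- Minty's theorem. The condition that `(x, γ⁻¹ • (y - x))` be monotonically related to `(a, u)` says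
that `x` lies in the closed ball with diameter the segment from `a` to `y - γ • u`. Monotonicity
says that the centres of these balls depend nonexpansively on the vectors `(a - (y - γ • u)) / 2`, whose norms are
the radii, so the balls have a common point by Kirszbraun's extension. -/
theorem IsMaximallyMonotone.exists_mem {E : Type*} [NormedAddCommGroup E] [InnerProductSpace ℝ E]
    [CompleteSpace E] {A : E → Set E} (hA : IsMaximallyMonotone A) {γ : ℝ} (hγ : 0 < γ) (y : E) :
    ∃ a, γ⁻¹ • (y - a) ∈ A a := by
  obtain ⟨x, hx⟩ := exists_forall_norm_sub_le
    (fun z : graph A => (2⁻¹ : ℝ) • (z.1.1 + (y - γ • z.1.2)))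
    (fun z : graph A => (2⁻¹ : ℝ) • (z.1.1 - (y - γ • z.1.2))) (by
      rintro ⟨⟨a, u⟩, hau⟩ ⟨⟨b, w⟩, hbw⟩
      have hm : 0 ≤ inner ℝ (a - b) (u - w) := hA.1 _ hau _ hbw
      dsimp only
      have e1 : (2⁻¹ : ℝ) • (a + (y - γ • u)) - (2⁻¹ : ℝ) • (b + (y - γ • w))
          = (2⁻¹ : ℝ) • ((a - b) - γ • (u - w)) := by module
      have e2 : (2⁻¹ : ℝ) • (a - (y - γ • u)) - (2⁻¹ : ℝ) • (b - (y - γ • w))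
          = (2⁻¹ : ℝ) • ((a - b) + γ • (u - w)) := by module
      rw [e1, e2, norm_smul, norm_smul]
      gcongr 1
      refine le_of_sq_le_sq ?_ (norm_nonneg _)
      rw [norm_sub_sq_real, norm_add_sq_real, real_inner_smul_right]
      nlinarith [mul_nonneg hγ.le hm])
  refine ⟨x, hA.mem_of_forall fun a u hu => ?_⟩
  have h := hx ⟨(a, u), hu⟩
  dsimp only at h
  set c := y - γ • u with hc
  have e1 : x - (2⁻¹ : ℝ) • (a + c) = (2⁻¹ : ℝ) • ((x - a) + (x - c)) := by module
  have e2 : (2⁻¹ : ℝ) • (a - c) = (2⁻¹ : ℝ) • ((x - c) - (x - a)) := by module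
  rw [e1, e2, norm_smul, norm_smul] at h
  have h := le_of_mul_le_mul_left h (by norm_num)
  have h := pow_le_pow_left₀ (norm_nonneg _) h 2
  rw [norm_sub_sq_real, norm_add_sq_real, real_inner_comm] at h
  have e3 : γ⁻¹ • (y - x) - u = -(γ⁻¹ • (x - c)) := by
    rw [hc, ← smul_neg]
    have : u = γ⁻¹ • (γ • u) := by rw [inv_smul_smul₀ hγ.ne']
    nth_rewrite 1 [this]
    module
  rw [e3, inner_neg_right, real_inner_smul_right, real_inner_comm]
  have : 0 ≤ γ⁻¹ := by positivity
  nlinarith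

/-- The resolvents of a maximally monotone operator are everywhere defined and single-valued. -/
theorem IsMaximallyMonotone.exists_resolvent_eq_singleton {E : Type*} [NormedAddCommGroup E]
    [InnerProductSpace ℝ E] [CompleteSpace E] {A : E → Set E} (hA : IsMaximallyMonotone A) {γ : ℝ}
    (hγ : 0 < γ) (y : E) : ∃ a, resolvent (γ • A) y = {a} := by
  obtain ⟨a, ha⟩ := hA.exists_mem hγ y
  refine ⟨a, Set.eq_singleton_iff_unique_mem.2 ⟨(mem_resolvent_smul hγ).2 ha, fun b hb => ?_⟩⟩
  rw [mem_resolvent_smul hγ] at hb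
  have h : 0 ≤ inner ℝ (b - a) (γ⁻¹ • (y - b) - γ⁻¹ • (y - a)) := hA.1 (b, _) hb (a, _) ha
  have e : γ⁻¹ • (y - b) - γ⁻¹ • (y - a) = -(γ⁻¹ • (b - a)) := by module
  rw [e, inner_neg_right, real_inner_smul_right, real_inner_self_eq_norm_sq] at h
  have h1 : 0 < γ⁻¹ := by positivity
  have h2 : ‖b - a‖ ^ 2 ≤ 0 := by nlinarith
  have h3 : ‖b - a‖ = 0 := by nlinarith [norm_nonneg (b - a)]
  exact sub_eq_zero.1 (norm_eq_zero.1 h3)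

end MonoOp

/-! ### Fejér monotone sequences -/

theorem norm_le_of_antitone_norm_sub {E : Type*} [SeminormedAddCommGroup E] {f : ℕ → E} {z : E}
    (h : Antitone fun n => ‖f n - z‖) (n : ℕ) : ‖f n‖ ≤ ‖f 0 - z‖ + ‖z‖ :=
  calc ‖f n‖ = ‖(f n - z) + z‖ := by rw [sub_add_cancel]
    _ ≤ ‖f n - z‖ + ‖z‖ := norm_add_le _ _
    _ ≤ _ := by gcongr; exact h n.zero_le

/-- Opial's lemma: a sequence that is Fejér monotone with respect to `Z`, and whose weak cluster points
lie in `Z`, converges weakly to a point of `Z`. -/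
theorem exists_weak_limit_of_fejer {E : Type*} [NormedAddCommGroup E] [InnerProductSpace ℝ E]
    [CompleteSpace E] {Z : Set E} (hZ : Z.Nonempty) {f : ℕ → E}
    (hmono : ∀ z ∈ Z, Antitone fun n => ‖f n - z‖)
    (hcluster : ∀ U : Ultrafilter ℕ, ↑U ≤ (atTop : Filter ℕ) → ∀ z,
      (∀ y, Tendsto (fun n => inner ℝ (f n) y) U (𝓝 (inner ℝ z y))) → z ∈ Z) :
    ∃ z ∈ Z, ∀ y, Tendsto (fun n => inner ℝ (f n) y) atTop (𝓝 (inner ℝ z y)) := by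
  obtain ⟨z₀, hz₀⟩ := hZ
  have hbdd := norm_le_of_antitone_norm_sub (hmono z₀ hz₀)
  have hlim : ∀ z ∈ Z, ∃ d, Tendsto (fun n => ‖f n - z‖ ^ 2) atTop (𝓝 d) := fun z hz =>
    ⟨_, (tendsto_atTop_ciInf (hmono z hz) ⟨0, by rintro _ ⟨n, rfl⟩; exact norm_nonneg _⟩).pow 2⟩
  -- polarisation: pairings with differences of points of `Z` converge, so that two cluster points
  -- in `Z` have the same pairing with their difference
  have hdiff : ∀ z ∈ Z, ∀ z' ∈ Z, ∃ d, Tendsto (fun n => inner ℝ (f n) (z - z')) atTop (𝓝 d) := by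
    intro z hz z' hz'
    obtain ⟨d, hd⟩ := hlim z hz
    obtain ⟨d', hd'⟩ := hlim z' hz'
    refine ⟨_, (((hd'.sub hd).add_const (‖z‖ ^ 2 - ‖z'‖ ^ 2)).div_const 2).congr fun n => ?_⟩
    rw [norm_sub_sq_real, norm_sub_sq_real, inner_sub_right]
    ring
  obtain ⟨z, hz⟩ := (Ultrafilter.of (atTop : Filter ℕ)).exists_weak_limit f _ (.of_forall hbdd)
  have hzZ := hcluster _ (Ultrafilter.of_le _) z hz
  refine ⟨z, hzZ, fun y => (tendsto_iff_ultrafilter _ _ _).2 fun V hV => ?_⟩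
  obtain ⟨z', hz'⟩ := V.exists_weak_limit f _ (.of_forall hbdd)
  have hz'Z := hcluster V hV z' hz'
  obtain ⟨d, hd⟩ := hdiff z hzZ z' hz'Z
  have h1 := tendsto_nhds_unique (hz (z - z')) (hd.mono_left (Ultrafilter.of_le _))
  have h2 := tendsto_nhds_unique (hz' (z - z')) (hd.mono_left hV)
  have h3 : inner ℝ (z - z') (z - z') = 0 := by rw [inner_sub_left, h1, h2, sub_self]
  rw [sub_eq_zero.1 (inner_self_eq_zero.1 h3)]
  exact hz' y

theorem tendsto_toWeakSpace_of_inner {ι E : Type*} [NormedAddCommGroup E] [InnerProductSpace ℝ E]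
    [CompleteSpace E] {l : Filter ι} {f : ι → E} {x : E}
    (h : ∀ y, Tendsto (fun i => inner ℝ (f i) y) l (𝓝 (inner ℝ x y))) :
    Tendsto (fun i => toWeakSpace ℝ E (f i)) l (𝓝 (toWeakSpace ℝ E x)) := by
  refine (WeakBilin.tendsto_iff_forall_eval_tendsto (topDualPairing ℝ E).flip ?_).2 fun φ => ?_
  · intro a b hab
    refine ext_inner_left ℝ fun v => ?_
    exact DFunLike.congr_fun hab (InnerProductSpace.toDual ℝ E v)
  · have key : ∀ z, φ z = inner ℝ z ((InnerProductSpace.toDual ℝ E).symm φ) := fun z => by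
      rw [real_inner_comm, InnerProductSpace.toDual_symm_apply]
    have := h ((InnerProductSpace.toDual ℝ E).symm φ)
    simp only [← key] at this
    exact this

theorem tendsto_inner_of_tendsto_zero {ι E : Type*} [NormedAddCommGroup E] [InnerProductSpace ℝ E]
    {l : Filter ι} {f g : ι → E} {C : ℝ} (hf : ∀ i, ‖f i‖ ≤ C) (hg : Tendsto g l (𝓝 0)) :
    Tendsto (fun i => inner ℝ (f i) (g i)) l (𝓝 0) := by
  refine squeeze_zero_norm (fun i => (norm_inner_le_norm _ _).trans
    (mul_le_mul_of_nonneg_right (hf i) (norm_nonneg _))) ?_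
  simpa using hg.norm.const_mul C

/-! ### The Kuhn–Tucker set -/

namespace MonoOp

section KuhnTucker

variable {H G : Type*} [NormedAddCommGroup H] [InnerProductSpace ℝ H] [CompleteSpace H]
  [NormedAddCommGroup G] [InnerProductSpace ℝ G] [CompleteSpace G]
  {A : H → Set H} {B : G → Set G} {L : H →L[ℝ] G}

theorem fst_mem_primalSolutions {z : H × G} (hz : z ∈ kuhnTucker A B L) :
    z.1 ∈ primalSolutions A B L :=
  Set.mem_add.2 ⟨_, hz.1, _, ⟨_, hz.2, rfl⟩, neg_add_cancel _⟩

theorem snd_mem_dualSolutions {z : H × G} (hz : z ∈ kuhnTucker A B L) :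
    z.2 ∈ dualSolutions A B L :=
  Set.mem_add.2 ⟨-L z.1, Set.neg_mem_neg.2 ⟨z.1, hz.1, rfl⟩, L z.1, hz.2, neg_add_cancel _⟩

theorem kuhnTucker_nonempty (h : (primalSolutions A B L).Nonempty) :
    (kuhnTucker A B L).Nonempty := by
  obtain ⟨x, hx⟩ := h
  obtain ⟨u, hu, -, ⟨v, hv, rfl⟩, huv⟩ := Set.mem_add.1 hx
  exact ⟨(x, v), by simpa [← eq_neg_of_add_eq_zero_left huv] using hu, hv⟩

/-- The Kuhn–Tucker set is described by monotonicity inequalities against pairs of graph points.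
This is the maximality of the sum of the product operator `A × B⁻¹` and the skew operator
`(x, v) ↦ (L* v, -L x)`, in the form in which it is used. -/
theorem mem_kuhnTucker_of_forall (hA : IsMaximallyMonotone A) (hB : IsMaximallyMonotone B)
    {x : H} {v : G}
    (h : ∀ a, ∀ u ∈ A a, ∀ b, ∀ w ∈ B b,
      0 ≤ inner ℝ (x - a) (-ContinuousLinearMap.adjoint L v - u) + inner ℝ (L x - b) (v - w)) :
    (x, v) ∈ kuhnTucker A B L := by
  have hxA : -ContinuousLinearMap.adjoint L v ∈ A x := by
    refine hA.mem_of_forall fun a u hu => ?_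
    -- a negative first term forces the second to be positive for all `(b, w)`, which puts
    -- `(L x, v)` itself on the graph of `B`, where the second term vanishes
    by_contra! hneg
    have hvB : v ∈ B (L x) := hB.mem_of_forall fun b w hw => by linarith [h a u hu b w hw]
    have := h a u hu _ _ hvB
    rw [sub_self (L x), inner_zero_left, add_zero] at this
    linarith
  refine ⟨hxA, hB.mem_of_forall fun b w hw => ?_⟩
  simpa using h x _ hxA b w hw

/-- Demiclosedness of the Kuhn–Tucker relations. The products `⟪L aᵢ, b'ᵢ⟫` of weakly convergent
families, which need not converge, cancel because `L` enters once directly and once through its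
adjoint. -/
theorem mem_kuhnTucker_of_tendsto (hA : IsMaximallyMonotone A) (hB : IsMaximallyMonotone B)
    {ι : Type*} {l : Filter ι} [l.NeBot] {a a' : ι → H} {b b' : ι → G} {x : H} {v : G} {C D : ℝ}
    (ha : ∀ i, a' i ∈ A (a i)) (hb : ∀ i, b' i ∈ B (b i))
    (haC : ∀ i, ‖a i‖ ≤ C) (hbD : ∀ i, ‖b' i‖ ≤ D)
    (hs : Tendsto (fun i => a' i + ContinuousLinearMap.adjoint L (b' i)) l (𝓝 0))
    (ht : Tendsto (fun i => b i - L (a i)) l (𝓝 0))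
    (hx : ∀ y, Tendsto (fun i => inner ℝ (a i) y) l (𝓝 (inner ℝ x y)))
    (hv : ∀ y, Tendsto (fun i => inner ℝ (b' i) y) l (𝓝 (inner ℝ v y))) :
    (x, v) ∈ kuhnTucker A B L := by
  refine mem_kuhnTucker_of_forall hA hB fun p u hu q w hw => ?_
  have hnonneg : ∀ i, 0 ≤ inner ℝ (a i - p) (a' i + ContinuousLinearMap.adjoint L (b' i))
      + inner ℝ (b' i - w) (b i - L (a i)) + inner ℝ (b' i) (L p - q)
      - inner ℝ (a i) u + inner ℝ p u - inner ℝ (a i) (ContinuousLinearMap.adjoint L w)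
      + inner ℝ q w := by
    intro i
    have h1 : 0 ≤ inner ℝ (a i - p) (a' i - u) := hA.1 (a i, a' i) (ha i) (p, u) hu
    have h2 : 0 ≤ inner ℝ (b i - q) (b' i - w) := hB.1 (b i, b' i) (hb i) (q, w) hw
    have c1 := real_inner_comm (b i) (b' i)
    have c2 := real_inner_comm (b i) w
    have c3 := real_inner_comm (L (a i)) (b' i)
    have c4 := real_inner_comm (L (a i)) w
    have c5 := real_inner_comm (L p) (b' i)
    have c6 := real_inner_comm q (b' i)
    simp only [inner_sub_left, inner_sub_right, inner_add_right,
      ContinuousLinearMap.adjoint_inner_right, map_sub] at h1 h2 ⊢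
    linarith
  have hlim := ((((((tendsto_inner_of_tendsto_zero (f := fun i => a i - p) (C := C + ‖p‖)
    (fun i => (norm_sub_le _ _).trans (by gcongr; exact haC i)) hs).add
    (tendsto_inner_of_tendsto_zero (f := fun i => b' i - w) (C := D + ‖w‖)
    (fun i => (norm_sub_le _ _).trans (by gcongr; exact hbD i)) ht)).add
    (hv (L p - q))).sub (hx u)).add_const (inner ℝ p u)).sub
    (hx (ContinuousLinearMap.adjoint L w))).add_const (inner ℝ q w)
  have h := ge_of_tendsto' hlim hnonneg
  have c3 := real_inner_comm (L x) v
  have c5 := real_inner_comm (L p) v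
  have c6 := real_inner_comm q v
  simp only [inner_sub_left, inner_sub_right, inner_neg_right,
    ContinuousLinearMap.adjoint_inner_right, map_sub] at h ⊢
  linarith

/-- The Kuhn–Tucker set lies in the half-space onto which an iteration of the algorithm projects. Its
normal vector is `(γ⁻¹ • (x - a) + μ⁻¹ • L* (L x - b), b - L a)`. -/
theorem le_inner_sub_of_mem_kuhnTucker (hA : IsMonotone A) (hB : IsMonotone B) {z : H × G}
    (hz : z ∈ kuhnTucker A B L) {γ μ : ℝ} {x a : H} {v b : G}
    (ha : γ⁻¹ • (x - a) - ContinuousLinearMap.adjoint L v ∈ A a)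
    (hb : μ⁻¹ • (L x - b) + v ∈ B b) :
    γ⁻¹ * ‖x - a‖ ^ 2 + μ⁻¹ * ‖L x - b‖ ^ 2 ≤
      inner ℝ (x - z.1) (γ⁻¹ • (x - a) + μ⁻¹ • ContinuousLinearMap.adjoint L (L x - b))
        + inner ℝ (v - z.2) (b - L a) := by
  obtain ⟨p, w⟩ := z
  have h1 : 0 ≤ inner ℝ (a - p) (γ⁻¹ • (x - a) - ContinuousLinearMap.adjoint L v
    - -ContinuousLinearMap.adjoint L w) := hA (a, _) ha (p, _) hz.1
  have h2 : 0 ≤ inner ℝ (b - L p) (μ⁻¹ • (L x - b) + v - w) := hB (b, _) hb (L p, _) hz.2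
  have ex : x - p = (x - a) + (a - p) := by abel
  have el : L x - L p = (L x - b) + (b - L p) := by abel
  have e1 : inner ℝ (x - p) (γ⁻¹ • (x - a))
      = γ⁻¹ * ‖x - a‖ ^ 2 + inner ℝ (a - p) (γ⁻¹ • (x - a)) := by
    rw [ex, inner_add_left, real_inner_smul_right, real_inner_self_eq_norm_sq]
  have e2 : inner ℝ (x - p) (μ⁻¹ • ContinuousLinearMap.adjoint L (L x - b))
      = μ⁻¹ * ‖L x - b‖ ^ 2 + inner ℝ (b - L p) (μ⁻¹ • (L x - b)) := by
    rw [real_inner_smul_right, ContinuousLinearMap.adjoint_inner_right, map_sub, el,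
      inner_add_left, real_inner_self_eq_norm_sq, real_inner_smul_right]
    ring
  have e3 : inner ℝ (v - w) (b - L a) = inner ℝ (b - L p) (v - w) - inner ℝ (L a - L p) (v - w) := by
    rw [real_inner_comm, ← inner_sub_left]
    congr 1
    abel
  have e4 : inner ℝ (a - p) (γ⁻¹ • (x - a) - ContinuousLinearMap.adjoint L v
      - -ContinuousLinearMap.adjoint L w)
      = inner ℝ (a - p) (γ⁻¹ • (x - a)) - inner ℝ (L a - L p) (v - w) := by
    have : γ⁻¹ • (x - a) - ContinuousLinearMap.adjoint L v - -ContinuousLinearMap.adjoint L w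
        = γ⁻¹ • (x - a) - ContinuousLinearMap.adjoint L (v - w) := by
      rw [map_sub]; abel
    rw [this, inner_sub_right, ContinuousLinearMap.adjoint_inner_right, map_sub]
  rw [add_sub_assoc, inner_add_right] at h2
  rw [e4] at h1
  rw [inner_add_right, e1, e2, e3]
  linarith

/-- The squared norm of the normal vector `(s, t)` is controlled by the lower bound in
`le_inner_sub_of_mem_kuhnTucker`, uniformly over the admissible parameters. -/
theorem norm_sq_add_norm_sq_le {ε γ μ : ℝ} (hε : 0 < ε) (hγ : γ ∈ Set.Icc ε (1 / ε))
    (hμ : μ ∈ Set.Icc ε (1 / ε)) (L : H →L[ℝ] G) (x a : H) (b : G) :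
    ‖γ⁻¹ • (x - a) + μ⁻¹ • ContinuousLinearMap.adjoint L (L x - b)‖ ^ 2 + ‖b - L a‖ ^ 2
      ≤ 2 * (1 + ‖L‖ ^ 2) / ε * (γ⁻¹ * ‖x - a‖ ^ 2 + μ⁻¹ * ‖L x - b‖ ^ 2) := by
  have hγ0 : 0 < γ := hε.trans_le hγ.1
  have hμ0 : 0 < μ := hε.trans_le hμ.1
  have inv_bounds : ∀ {r : ℝ}, r ∈ Set.Icc ε (1 / ε) → ε ≤ r⁻¹ ∧ r⁻¹ ≤ ε⁻¹ := fun {r} hr =>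
    ⟨by simpa using inv_anti₀ (hε.trans_le hr.1) hr.2, inv_anti₀ hε hr.1⟩
  obtain ⟨hg1, hg2⟩ := inv_bounds hγ
  obtain ⟨hm1, hm2⟩ := inv_bounds hμ
  set g := γ⁻¹
  set m := μ⁻¹
  have hg0 : 0 < g := hε.trans_le hg1
  have hm0 : 0 < m := hε.trans_le hm1
  set X := ‖x - a‖ with hX
  set Y := ‖L x - b‖ with hY
  set K := ‖L‖
  have hs : ‖g • (x - a) + m • ContinuousLinearMap.adjoint L (L x - b)‖ ≤ g * X + m * (K * Y) := by
    refine (norm_add_le _ _).trans ?_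
    rw [norm_smul, norm_smul, Real.norm_of_nonneg hg0.le, Real.norm_of_nonneg hm0.le]
    gcongr
    refine (ContinuousLinearMap.le_opNorm _ _).trans ?_
    rw [LinearIsometryEquiv.norm_map]
  have ht : ‖b - L a‖ ≤ Y + K * X := by
    have : b - L a = L (x - a) - (L x - b) := by rw [map_sub]; abel
    rw [this, add_comm]
    refine (norm_sub_le _ _).trans ?_
    gcongr
    exact L.le_opNorm _
  have hs2 := pow_le_pow_left₀ (norm_nonneg _) hs 2
  have ht2 := pow_le_pow_left₀ (norm_nonneg _) ht 2
  have two_sq : ∀ r r' : ℝ, (r + r') ^ 2 ≤ 2 * (r ^ 2 + r' ^ 2) := fun r r' => by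
    nlinarith [sq_nonneg (r - r')]
  have b1 : g ^ 2 ≤ g / ε := by
    rw [sq, div_eq_mul_inv]; gcongr
  have b2 : m ^ 2 ≤ m / ε := by
    rw [sq, div_eq_mul_inv]; gcongr
  have b3 : 1 ≤ g / ε := (one_le_div hε).2 hg1
  have b4 : 1 ≤ m / ε := (one_le_div hε).2 hm1
  calc _ ≤ 2 * ((g * X) ^ 2 + (m * (K * Y)) ^ 2) + 2 * (Y ^ 2 + (K * X) ^ 2) :=
        add_le_add (hs2.trans (two_sq _ _)) (ht2.trans (two_sq _ _))
    _ = 2 * (g ^ 2 * X ^ 2 + m ^ 2 * (K ^ 2 * Y ^ 2) + 1 * Y ^ 2 + 1 * (K ^ 2 * X ^ 2)) := by ring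
    _ ≤ 2 * (g / ε * X ^ 2 + m / ε * (K ^ 2 * Y ^ 2) + m / ε * Y ^ 2
          + g / ε * (K ^ 2 * X ^ 2)) := by gcongr
    _ = _ := by ring

end KuhnTucker

end MonoOp

/-! ### Runs of the algorithm -/

theorem tendsto_zero_of_summable_norm_sq {E : Type*} [NormedAddCommGroup E] {f : ℕ → E}
    (hf : Summable fun n => ‖f n‖ ^ 2) : Tendsto f atTop (𝓝 0) := by
  have h := hf.tendsto_atTop_zero.sqrt
  simp only [Real.sqrt_sq (norm_nonneg _), Real.sqrt_zero] at h
  exact tendsto_zero_iff_norm_tendsto_zero.2 h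

namespace MonoOp

section Run

variable {H G : Type*} [NormedAddCommGroup H] [InnerProductSpace ℝ H] [CompleteSpace H]
  [NormedAddCommGroup G] [InnerProductSpace ℝ G] [CompleteSpace G]
  {A : H → Set H} {B : G → Set G} {L : H →L[ℝ] G} {γ μ lam : ℕ → ℝ} {x₀ : H} {v₀ : G}
  {T : Iterates H G} {n : ℕ}

theorem exists_isRun (hA : IsMaximallyMonotone A) (hB : IsMaximallyMonotone B) (L : H →L[ℝ] G)
    (hγ : ∀ n, 0 < γ n) (hμ : ∀ n, 0 < μ n) (lam : ℕ → ℝ) (x₀ : H) (v₀ : G) :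
    ∃ T : Iterates H G, IsRun A B L γ μ lam x₀ v₀ T := by
  choose JA hJA using fun n => hA.exists_resolvent_eq_singleton (hγ n)
  choose JB hJB using fun n => hB.exists_resolvent_eq_singleton (hμ n)
  let a : ℕ → H × G → H := fun n z => JA n (z.1 - γ n • ContinuousLinearMap.adjoint L z.2)
  let b : ℕ → H × G → G := fun n z => JB n (L z.1 + μ n • z.2)
  let s : ℕ → H × G → H := fun n z =>
    (γ n)⁻¹ • (z.1 - a n z) + (μ n)⁻¹ • ContinuousLinearMap.adjoint L (L z.1 - b n z)
  let t : ℕ → H × G → G := fun n z => b n z - L (a n z)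
  let τ : ℕ → H × G → ℝ := fun n z => ‖s n z‖ ^ 2 + ‖t n z‖ ^ 2
  let θ : ℕ → H × G → ℝ := fun n z =>
    lam n * ((γ n)⁻¹ * ‖z.1 - a n z‖ ^ 2 + (μ n)⁻¹ * ‖L z.1 - b n z‖ ^ 2) / τ n z
  let z : ℕ → H × G := fun n => Nat.rec (x₀, v₀)
    (fun n z => (z.1 - θ n z • s n z, z.2 - θ n z • t n z)) n
  exact ⟨⟨fun n => (z n).1, fun n => (z n).2, fun n => a n (z n), fun n => L (z n).1,
    fun n => b n (z n), fun n => s n (z n), fun n => t n (z n), fun n => τ n (z n),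
    fun n => θ n (z n)⟩,
    { init_x := rfl
      init_v := rfl
      a_eq := fun _ _ => hJA _ _
      l_eq := fun _ _ => rfl
      b_eq := fun _ _ => hJB _ _
      s_eq := fun _ _ => rfl
      t_eq := fun _ _ => rfl
      τ_eq := fun _ _ => rfl
      θ_eq := fun _ _ _ => rfl
      x_succ := fun _ _ _ => rfl
      v_succ := fun _ _ _ => rfl }⟩

theorem IsRun.mem_left (hT : IsRun A B L γ μ lam x₀ v₀ T) (hn : T.Reaches n) (hγ : 0 < γ n) :
    (γ n)⁻¹ • (T.x n - T.a n) - ContinuousLinearMap.adjoint L (T.v n) ∈ A (T.a n) := by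
  have h : T.a n ∈ resolvent (γ n • A) (T.x n - γ n • ContinuousLinearMap.adjoint L (T.v n)) :=
    hT.a_eq n hn ▸ Set.mem_singleton _
  rw [mem_resolvent_smul hγ, sub_right_comm, smul_sub _ (T.x n - T.a n),
    inv_smul_smul₀ hγ.ne'] at h
  exact h

theorem IsRun.mem_right (hT : IsRun A B L γ μ lam x₀ v₀ T) (hn : T.Reaches n) (hμ : 0 < μ n) :
    (μ n)⁻¹ • (L (T.x n) - T.b n) + T.v n ∈ B (T.b n) := by
  have h : T.b n ∈ resolvent (μ n • B) (T.l n + μ n • T.v n) :=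
    hT.b_eq n hn ▸ Set.mem_singleton _
  rw [mem_resolvent_smul hμ, hT.l_eq n hn, add_sub_right_comm, smul_add,
    inv_smul_smul₀ hμ.ne'] at h
  exact h

/-- The quantity `γₙ⁻¹ ‖xₙ - aₙ‖² + μₙ⁻¹ ‖L xₙ - bₙ‖²`, the numerator of the step size up to the
relaxation parameter. -/
noncomputable def Iterates.gap (T : Iterates H G) (L : H →L[ℝ] G) (γ μ : ℕ → ℝ) (n : ℕ) : ℝ :=
  (γ n)⁻¹ * ‖T.x n - T.a n‖ ^ 2 + (μ n)⁻¹ * ‖L (T.x n) - T.b n‖ ^ 2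

theorem IsRun.mem_kuhnTucker_of_τ_eq_zero (hT : IsRun A B L γ μ lam x₀ v₀ T) (hn : T.Reaches n)
    (hγ : 0 < γ n) (hμ : 0 < μ n) (hτ : T.τ n = 0) :
    (T.a n, T.v n + (μ n)⁻¹ • (T.l n - T.b n)) ∈ kuhnTucker A B L := by
  have h := hT.τ_eq n hn
  rw [hτ] at h
  have hs : T.s n = 0 := by
    rw [← norm_eq_zero, ← sq_eq_zero_iff]
    linarith [sq_nonneg ‖T.s n‖, sq_nonneg ‖T.t n‖]
  have ht : T.t n = 0 := by
    rw [← norm_eq_zero, ← sq_eq_zero_iff]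
    linarith [sq_nonneg ‖T.s n‖, sq_nonneg ‖T.t n‖]
  rw [hT.s_eq n hn] at hs
  rw [hT.t_eq n hn, sub_eq_zero] at ht
  constructor
  · have e : -ContinuousLinearMap.adjoint L (T.v n + (μ n)⁻¹ • (T.l n - T.b n))
        = (γ n)⁻¹ • (T.x n - T.a n) - ContinuousLinearMap.adjoint L (T.v n) := by
      rw [eq_neg_of_add_eq_zero_left hs, map_add, map_smul]
      abel
    simpa only [e] using hT.mem_left hn hγ
  · change _ ∈ B (L (T.a n))
    rw [← ht, add_comm, hT.l_eq n hn]
    exact hT.mem_right hn hμ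

theorem IsRun.τ_le (hT : IsRun A B L γ μ lam x₀ v₀ T) (hn : T.Reaches n) {ε : ℝ} (hε : 0 < ε)
    (hγ : γ n ∈ Set.Icc ε (1 / ε)) (hμ : μ n ∈ Set.Icc ε (1 / ε)) :
    T.τ n ≤ 2 * (1 + ‖L‖ ^ 2) / ε * T.gap L γ μ n := by
  rw [hT.τ_eq n hn, hT.s_eq n hn, hT.t_eq n hn, hT.l_eq n hn]
  exact norm_sq_add_norm_sq_le hε hγ hμ L _ _ _

theorem IsRun.θ_eq_gap (hT : IsRun A B L γ μ lam x₀ v₀ T) (hn : T.Reaches n) (hτ : 0 < T.τ n) :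
    T.θ n = lam n * T.gap L γ μ n / T.τ n := by
  rw [hT.θ_eq n hn hτ, hT.l_eq n hn, Iterates.gap]

theorem IsRun.norm_step_sq (hT : IsRun A B L γ μ lam x₀ v₀ T) (hn : T.Reaches n)
    (hτ : 0 < T.τ n) :
    ‖T.x (n + 1) - T.x n‖ ^ 2 + ‖T.v (n + 1) - T.v n‖ ^ 2
      = lam n ^ 2 * (T.gap L γ μ n ^ 2 / T.τ n) := by
  rw [hT.x_succ n hn hτ, hT.v_succ n hn hτ, sub_sub_cancel_left, sub_sub_cancel_left, norm_neg,
    norm_neg, norm_smul, norm_smul, mul_pow, mul_pow, Real.norm_eq_abs, sq_abs, ← mul_add,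
    ← hT.τ_eq n hn, hT.θ_eq_gap hn hτ]
  field_simp

/-- One iteration is a relaxed projection onto a half-space containing the Kuhn–Tucker set, and so
does not increase the distance to any Kuhn–Tucker point. -/
theorem IsRun.fejer (hT : IsRun A B L γ μ lam x₀ v₀ T) (hA : IsMonotone A) (hB : IsMonotone B)
    (hn : T.Reaches n) (hτ : 0 < T.τ n) (hγ : 0 < γ n) (hμ : 0 < μ n) (hlam : 0 ≤ lam n)
    {z : H × G} (hz : z ∈ kuhnTucker A B L) :
    lam n * (2 - lam n) * (T.gap L γ μ n ^ 2 / T.τ n) ≤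
      ‖T.x n - z.1‖ ^ 2 + ‖T.v n - z.2‖ ^ 2
        - (‖T.x (n + 1) - z.1‖ ^ 2 + ‖T.v (n + 1) - z.2‖ ^ 2) := by
  have hkey := le_inner_sub_of_mem_kuhnTucker hA hB hz (hT.mem_left hn hγ) (hT.mem_right hn hμ)
  rw [← hT.l_eq n hn, ← hT.s_eq n hn, ← hT.t_eq n hn, hT.l_eq n hn] at hkey
  change T.gap L γ μ n ≤ _ at hkey
  have hstep := hT.norm_step_sq hn hτ
  have hgap : 0 ≤ T.gap L γ μ n := by unfold Iterates.gap; positivity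
  have hθ : 0 ≤ T.θ n := by rw [hT.θ_eq_gap hn hτ]; positivity
  have hθgap : T.θ n * T.gap L γ μ n = lam n * (T.gap L γ μ n ^ 2 / T.τ n) := by
    rw [hT.θ_eq_gap hn hτ]; ring
  have ex : T.x (n + 1) - z.1 = (T.x n - z.1) + (T.x (n + 1) - T.x n) := by abel
  have ev : T.v (n + 1) - z.2 = (T.v n - z.2) + (T.v (n + 1) - T.v n) := by abel
  have ix : inner ℝ (T.x n - z.1) (T.x (n + 1) - T.x n)
      = -(T.θ n * inner ℝ (T.x n - z.1) (T.s n)) := by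
    rw [hT.x_succ n hn hτ, sub_sub_cancel_left, inner_neg_right, real_inner_smul_right]
  have iv : inner ℝ (T.v n - z.2) (T.v (n + 1) - T.v n)
      = -(T.θ n * inner ℝ (T.v n - z.2) (T.t n)) := by
    rw [hT.v_succ n hn hτ, sub_sub_cancel_left, inner_neg_right, real_inner_smul_right]
  rw [ex, ev, norm_add_sq_real, norm_add_sq_real, ix, iv]
  have := mul_le_mul_of_nonneg_left hkey hθ
  linarith

end Run

/-! ### Infinite runs -/

/-- The data of an infinite run: all iterations are executed and the parameters stay in the
prescribed ranges. -/
structure IsInfiniteRun {H G : Type*} [NormedAddCommGroup H] [InnerProductSpace ℝ H]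
    [CompleteSpace H] [NormedAddCommGroup G] [InnerProductSpace ℝ G] [CompleteSpace G]
    (A : H → Set H) (B : G → Set G) (L : H →L[ℝ] G) (γ μ lam : ℕ → ℝ)
    (x₀ : H) (v₀ : G) (ε : ℝ) (T : Iterates H G) : Prop where
  isRun : IsRun A B L γ μ lam x₀ v₀ T
  ε_pos : 0 < ε
  mem_γ : ∀ n, γ n ∈ Set.Icc ε (1 / ε)
  mem_μ : ∀ n, μ n ∈ Set.Icc ε (1 / ε)
  mem_lam : ∀ n, lam n ∈ Set.Icc ε (2 - ε)
  τ_pos : ∀ n, 0 < T.τ n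

namespace IsInfiniteRun

variable {H G : Type*} [NormedAddCommGroup H] [InnerProductSpace ℝ H] [CompleteSpace H]
  [NormedAddCommGroup G] [InnerProductSpace ℝ G] [CompleteSpace G]
  {A : H → Set H} {B : G → Set G} {L : H →L[ℝ] G} {γ μ lam : ℕ → ℝ} {x₀ : H} {v₀ : G} {ε : ℝ}
  {T : Iterates H G}

theorem reaches (h : IsInfiniteRun A B L γ μ lam x₀ v₀ ε T) (n : ℕ) : T.Reaches n :=
  fun k _ => (h.τ_pos k).ne'

theorem γ_pos (h : IsInfiniteRun A B L γ μ lam x₀ v₀ ε T) (n : ℕ) : 0 < γ n :=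
  h.ε_pos.trans_le (h.mem_γ n).1

theorem μ_pos (h : IsInfiniteRun A B L γ μ lam x₀ v₀ ε T) (n : ℕ) : 0 < μ n :=
  h.ε_pos.trans_le (h.mem_μ n).1

theorem gap_nonneg (h : IsInfiniteRun A B L γ μ lam x₀ v₀ ε T) (n : ℕ) : 0 ≤ T.gap L γ μ n := by
  have := h.γ_pos n
  have := h.μ_pos n
  unfold Iterates.gap
  positivity

theorem fejer (h : IsInfiniteRun A B L γ μ lam x₀ v₀ ε T) (hA : IsMonotone A) (hB : IsMonotone B)
    {z : H × G} (hz : z ∈ kuhnTucker A B L) (n : ℕ) :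
    ε ^ 2 * (T.gap L γ μ n ^ 2 / T.τ n) ≤
      ‖T.x n - z.1‖ ^ 2 + ‖T.v n - z.2‖ ^ 2
        - (‖T.x (n + 1) - z.1‖ ^ 2 + ‖T.v (n + 1) - z.2‖ ^ 2) := by
  obtain ⟨h1, h2⟩ := h.mem_lam n
  have hε := h.ε_pos
  refine le_trans ?_ (h.isRun.fejer hA hB (h.reaches n) (h.τ_pos n) (h.γ_pos n) (h.μ_pos n)
    (hε.le.trans h1) hz)
  have := h.τ_pos n
  refine mul_le_mul_of_nonneg_right ?_ (by positivity)
  rw [sq]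
  exact mul_le_mul h1 (by linarith) hε.le (hε.le.trans h1)

theorem summable_gap_sq_div (h : IsInfiniteRun A B L γ μ lam x₀ v₀ ε T) (hA : IsMonotone A)
    (hB : IsMonotone B) (hZ : (kuhnTucker A B L).Nonempty) :
    Summable fun n => T.gap L γ μ n ^ 2 / T.τ n := by
  obtain ⟨z, hz⟩ := hZ
  have hε := h.ε_pos
  rw [← summable_mul_left_iff (pow_ne_zero 2 hε.ne')]
  refine summable_of_sum_range_le (c := ‖T.x 0 - z.1‖ ^ 2 + ‖T.v 0 - z.2‖ ^ 2)
    (fun n => by have := h.τ_pos n; positivity) fun n => ?_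
  refine (Finset.sum_le_sum fun i _ => h.fejer hA hB hz i).trans ?_
  rw [Finset.sum_range_sub' (fun i => ‖T.x i - z.1‖ ^ 2 + ‖T.v i - z.2‖ ^ 2)]
  linarith [sq_nonneg ‖T.x n - z.1‖, sq_nonneg ‖T.v n - z.2‖]

/-- Since `τ ≤ C * gap`, summability of `gap² / τ` gives summability of `gap`. -/
theorem summable_gap (h : IsInfiniteRun A B L γ μ lam x₀ v₀ ε T) (hA : IsMonotone A)
    (hB : IsMonotone B) (hZ : (kuhnTucker A B L).Nonempty) :
    Summable (T.gap L γ μ) := by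
  refine .of_nonneg_of_le h.gap_nonneg (fun n => ?_)
    ((h.summable_gap_sq_div hA hB hZ).mul_left (2 * (1 + ‖L‖ ^ 2) / ε))
  have hτ := h.τ_pos n
  rw [← mul_div_assoc, le_div_iff₀ hτ]
  nlinarith [mul_le_mul_of_nonneg_left
    (h.isRun.τ_le (h.reaches n) h.ε_pos (h.mem_γ n) (h.mem_μ n)) (h.gap_nonneg n)]

theorem summable_τ (h : IsInfiniteRun A B L γ μ lam x₀ v₀ ε T) (hA : IsMonotone A)
    (hB : IsMonotone B) (hZ : (kuhnTucker A B L).Nonempty) : Summable T.τ :=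
  .of_nonneg_of_le (fun n => (h.τ_pos n).le)
    (fun n => h.isRun.τ_le (h.reaches n) h.ε_pos (h.mem_γ n) (h.mem_μ n))
    ((h.summable_gap hA hB hZ).mul_left _)

theorem summable_norm_s_sq_and_norm_t_sq (h : IsInfiniteRun A B L γ μ lam x₀ v₀ ε T)
    (hA : IsMonotone A) (hB : IsMonotone B) (hZ : (kuhnTucker A B L).Nonempty) :
    Summable (fun n => ‖T.s n‖ ^ 2) ∧ Summable (fun n => ‖T.t n‖ ^ 2) := by
  have hs := h.summable_τ hA hB hZ
  constructor <;> refine .of_nonneg_of_le (fun n => by positivity) (fun n => ?_) hs <;>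
    rw [h.isRun.τ_eq n (h.reaches n)] <;> linarith [sq_nonneg ‖T.s n‖, sq_nonneg ‖T.t n‖]

theorem summable_norm_step_sq (h : IsInfiniteRun A B L γ μ lam x₀ v₀ ε T)
    (hA : IsMonotone A) (hB : IsMonotone B) (hZ : (kuhnTucker A B L).Nonempty) :
    Summable (fun n => ‖T.x (n + 1) - T.x n‖ ^ 2) ∧
      Summable (fun n => ‖T.v (n + 1) - T.v n‖ ^ 2) := by
  have hs := (h.summable_gap_sq_div hA hB hZ).mul_left 4
  have hle : ∀ n, ‖T.x (n + 1) - T.x n‖ ^ 2 + ‖T.v (n + 1) - T.v n‖ ^ 2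
      ≤ 4 * (T.gap L γ μ n ^ 2 / T.τ n) := by
    intro n
    obtain ⟨h1, h2⟩ := h.mem_lam n
    have hε := h.ε_pos
    have hτ := h.τ_pos n
    rw [h.isRun.norm_step_sq (h.reaches n) hτ]
    gcongr
    -- `lam n ≤ 2`, hence the factor `4`
    nlinarith
  constructor <;> refine .of_nonneg_of_le (fun n => by positivity) (fun n => ?_) hs <;>
    linarith [hle n, sq_nonneg ‖T.x (n + 1) - T.x n‖, sq_nonneg ‖T.v (n + 1) - T.v n‖]

theorem summable_norm_sub_sq (h : IsInfiniteRun A B L γ μ lam x₀ v₀ ε T)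
    (hA : IsMonotone A) (hB : IsMonotone B) (hZ : (kuhnTucker A B L).Nonempty) :
    Summable (fun n => ‖T.x n - T.a n‖ ^ 2) ∧
      Summable (fun n => ‖L (T.x n) - T.b n‖ ^ 2) := by
  have hε := h.ε_pos
  have hs := (h.summable_gap hA hB hZ).mul_left ε⁻¹
  have hle : ∀ n, ‖T.x n - T.a n‖ ^ 2 + ‖L (T.x n) - T.b n‖ ^ 2 ≤ ε⁻¹ * T.gap L γ μ n := by
    intro n
    have hγ : ε ≤ (γ n)⁻¹ := by simpa using inv_anti₀ (h.γ_pos n) (h.mem_γ n).2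
    have hμ : ε ≤ (μ n)⁻¹ := by simpa using inv_anti₀ (h.μ_pos n) (h.mem_μ n).2
    rw [le_inv_mul_iff₀ hε, mul_add, Iterates.gap]
    gcongr
  constructor <;> refine .of_nonneg_of_le (fun n => by positivity) (fun n => ?_) hs <;>
    linarith [hle n, sq_nonneg ‖T.x n - T.a n‖, sq_nonneg ‖L (T.x n) - T.b n‖]

theorem mem_kuhnTucker_of_ultrafilter (h : IsInfiniteRun A B L γ μ lam x₀ v₀ ε T)
    (hA : IsMaximallyMonotone A) (hB : IsMaximallyMonotone B)
    (hZ : (kuhnTucker A B L).Nonempty) {C D : ℝ} (hC : ∀ n, ‖T.x n‖ ≤ C) (hD : ∀ n, ‖T.v n‖ ≤ D)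
    {U : Ultrafilter ℕ} (hU : ↑U ≤ (atTop : Filter ℕ)) {x : H} {v : G}
    (hx : ∀ y, Tendsto (fun n => inner ℝ (T.x n) y) U (𝓝 (inner ℝ x y)))
    (hv : ∀ y, Tendsto (fun n => inner ℝ (T.v n) y) U (𝓝 (inner ℝ v y))) :
    (x, v) ∈ kuhnTucker A B L := by
  have hs := h.summable_norm_s_sq_and_norm_t_sq hA.1 hB.1 hZ
  have hd := h.summable_norm_sub_sq hA.1 hB.1 hZ
  have hs0 := tendsto_zero_of_summable_norm_sq hs.1
  have ht0 := tendsto_zero_of_summable_norm_sq hs.2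
  have hxa := tendsto_zero_of_summable_norm_sq hd.1
  have hlb : Tendsto (fun n => (μ n)⁻¹ • (L (T.x n) - T.b n)) atTop (𝓝 0) := by
    refine squeeze_zero_norm (fun n => ?_)
      (by simpa using (tendsto_zero_of_summable_norm_sq hd.2).norm.const_mul ε⁻¹)
    have := h.μ_pos n
    rw [norm_smul, Real.norm_of_nonneg (by positivity)]
    gcongr
    · exact h.ε_pos
    · exact (h.mem_μ n).1
  obtain ⟨c, hc⟩ := hxa.norm.bddAbove_range
  obtain ⟨d, hd⟩ := hlb.norm.bddAbove_range
  refine mem_kuhnTucker_of_tendsto hA hB (l := (U : Filter ℕ)) (C := C + c) (D := d + D)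
    (fun n => h.isRun.mem_left (h.reaches n) (h.γ_pos n))
    (fun n => h.isRun.mem_right (h.reaches n) (h.μ_pos n)) (fun n => ?_) (fun n => ?_)
    ((hs0.mono_left hU).congr fun n => ?_) ((ht0.mono_left hU).congr fun n => ?_)
    (fun y => ?_) (fun y => ?_)
  · rw [← sub_sub_self (T.x n) (T.a n)]
    exact (norm_sub_le _ _).trans (add_le_add (hC n) (hc ⟨n, rfl⟩))
  · exact (norm_add_le _ _).trans (add_le_add (hd ⟨n, rfl⟩) (hD n))
  · rw [h.isRun.s_eq n (h.reaches n), h.isRun.l_eq n (h.reaches n), map_add, map_smul]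
    abel
  · exact h.isRun.t_eq n (h.reaches n)
  · have h0 : Tendsto (fun n => inner ℝ (T.x n - T.a n) y) U (𝓝 0) := by
      simpa using (hxa.mono_left hU).inner (tendsto_const_nhds (x := y))
    simpa [← inner_sub_left] using (hx y).sub h0
  · have h0 : Tendsto (fun n => inner ℝ ((μ n)⁻¹ • (L (T.x n) - T.b n)) y) U (𝓝 0) := by
      simpa using (hlb.mono_left hU).inner (tendsto_const_nhds (x := y))
    simpa [← inner_add_left] using h0.add (hv y)

theorem exists_weak_limit (h : IsInfiniteRun A B L γ μ lam x₀ v₀ ε T)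
    (hA : IsMaximallyMonotone A) (hB : IsMaximallyMonotone B)
    (hZ : (kuhnTucker A B L).Nonempty) :
    ∃ z ∈ kuhnTucker A B L,
      (∀ y, Tendsto (fun n => inner ℝ (T.x n) y) atTop (𝓝 (inner ℝ z.1 y))) ∧
      ∀ y, Tendsto (fun n => inner ℝ (T.v n) y) atTop (𝓝 (inner ℝ z.2 y)) := by
  let f : ℕ → WithLp 2 (H × G) := fun n => WithLp.toLp 2 (T.x n, T.v n)
  let Z : Set (WithLp 2 (H × G)) := WithLp.ofLp ⁻¹' kuhnTucker A B L
  have hne : Z.Nonempty := hZ.preimage (WithLp.ofLp_surjective 2)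
  have hmono : ∀ z ∈ Z, Antitone fun n => ‖f n - z‖ := by
    intro z hz
    refine antitone_nat_of_succ_le fun n => le_of_sq_le_sq ?_ (norm_nonneg _)
    rw [WithLp.prod_norm_sq_eq_of_L2, WithLp.prod_norm_sq_eq_of_L2]
    have hτ := h.τ_pos n
    have h0 : 0 ≤ ε ^ 2 * (T.gap L γ μ n ^ 2 / T.τ n) := by positivity
    exact sub_nonneg.1 (h0.trans (h.fejer hA.1 hB.1 hz n))
  obtain ⟨C, hC⟩ : ∃ C, ∀ n, ‖f n‖ ≤ C :=
    hne.elim fun z hz => ⟨_, norm_le_of_antitone_norm_sub (hmono z hz)⟩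
  -- weak convergence in the Hilbert direct sum is weak convergence of both components
  have components : ∀ (l : Filter ℕ) (z : WithLp 2 (H × G)),
      (∀ y, Tendsto (fun n => inner ℝ (f n) y) l (𝓝 (inner ℝ z y))) →
      (∀ y, Tendsto (fun n => inner ℝ (T.x n) y) l (𝓝 (inner ℝ z.fst y))) ∧
      ∀ y, Tendsto (fun n => inner ℝ (T.v n) y) l (𝓝 (inner ℝ z.snd y)) := by
    intro l z hz
    exact ⟨fun y => by simpa [f, WithLp.prod_inner_apply] using hz (WithLp.toLp 2 (y, 0)),
      fun y => by simpa [f, WithLp.prod_inner_apply] using hz (WithLp.toLp 2 (0, y))⟩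
  obtain ⟨z, hz, hlim⟩ := exists_weak_limit_of_fejer hne hmono fun U hU z hz =>
    h.mem_kuhnTucker_of_ultrafilter hA hB hZ
      (fun n => (WithLp.norm_fst_le _ (f n)).trans (hC n))
      (fun n => (WithLp.norm_snd_le _ (f n)).trans (hC n)) hU
      (components U z hz).1 (components U z hz).2
  exact ⟨_, hz, components atTop z hlim⟩

end IsInfiniteRun

end MonoOp

theorem mainTheorem2 {H G : Type*}
    [NormedAddCommGroup H] [InnerProductSpace ℝ H] [CompleteSpace H]
    [NormedAddCommGroup G] [InnerProductSpace ℝ G] [CompleteSpace G]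
    (A : H → Set H) (B : G → Set G) (L : H →L[ℝ] G)
    (hA : MonoOp.IsMaximallyMonotone A) (hB : MonoOp.IsMaximallyMonotone B)
    (hP : (MonoOp.primalSolutions A B L).Nonempty)
    (ε : ℝ) (hε : ε ∈ Set.Ioo (0 : ℝ) 1) (x₀ : H) (v₀ : G) (γ μ lam : ℕ → ℝ)
    (hγ : ∀ n, γ n ∈ Set.Icc ε (1 / ε)) (hμ : ∀ n, μ n ∈ Set.Icc ε (1 / ε))
    (hlam : ∀ n, lam n ∈ Set.Icc ε (2 - ε)) :
    -- the algorithm is well defined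
    (∃ T : MonoOp.Iterates H G, MonoOp.IsRun A B L γ μ lam x₀ v₀ T) ∧
    ∀ T : MonoOp.Iterates H G, MonoOp.IsRun A B L γ μ lam x₀ v₀ T →
      -- either it terminates at a Kuhn-Tucker point
      (∃ n, T.Reaches n ∧ T.τ n = 0 ∧
        (T.a n, T.v n + (μ n)⁻¹ • (T.l n - T.b n)) ∈ MonoOp.kuhnTucker A B L) ∨
      -- or it generates infinite sequences with the following properties
      ((∀ n, 0 < T.τ n) ∧
        (Summable (fun n => ‖T.s n‖ ^ 2) ∧ Summable (fun n => ‖T.t n‖ ^ 2)) ∧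
        (Summable (fun n => ‖T.x (n + 1) - T.x n‖ ^ 2) ∧
          Summable (fun n => ‖T.v (n + 1) - T.v n‖ ^ 2)) ∧
        (Summable (fun n => ‖T.x n - T.a n‖ ^ 2) ∧
          Summable (fun n => ‖L (T.x n) - T.b n‖ ^ 2)) ∧
        ∃ xbar ∈ MonoOp.primalSolutions A B L, ∃ vbar ∈ MonoOp.dualSolutions A B L,
          Tendsto (fun n => toWeakSpace ℝ H (T.x n)) atTop (𝓝 (toWeakSpace ℝ H xbar)) ∧
          Tendsto (fun n => toWeakSpace ℝ G (T.v n)) atTop (𝓝 (toWeakSpace ℝ G vbar)) ∧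
          (xbar, vbar) ∈ MonoOp.kuhnTucker A B L) := by
  have hγ0 : ∀ n, 0 < γ n := fun n => hε.1.trans_le (hγ n).1
  have hμ0 : ∀ n, 0 < μ n := fun n => hε.1.trans_le (hμ n).1
  refine ⟨MonoOp.exists_isRun hA hB L hγ0 hμ0 lam x₀ v₀, fun T hT => ?_⟩
  by_cases hterm : ∃ n, T.Reaches n ∧ T.τ n = 0
  · obtain ⟨n, hn, hτ⟩ := hterm
    exact Or.inl ⟨n, hn, hτ, hT.mem_kuhnTucker_of_τ_eq_zero hn (hγ0 n) (hμ0 n) hτ⟩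
  push Not at hterm
  have hne : ∀ n, T.τ n ≠ 0 := fun n => Nat.strong_induction_on n hterm
  have hτ : ∀ n, 0 < T.τ n := fun n =>
    lt_of_le_of_ne (by rw [hT.τ_eq n fun k _ => hne k]; positivity) (hne n).symm
  have hI : MonoOp.IsInfiniteRun A B L γ μ lam x₀ v₀ ε T := ⟨hT, hε.1, hγ, hμ, hlam, hτ⟩
  have hZ := MonoOp.kuhnTucker_nonempty hP
  obtain ⟨z, hz, hx, hv⟩ := hI.exists_weak_limit hA hB hZ
  exact Or.inr ⟨hτ, hI.summable_norm_s_sq_and_norm_t_sq hA.1 hB.1 hZ,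
    hI.summable_norm_step_sq hA.1 hB.1 hZ, hI.summable_norm_sub_sq hA.1 hB.1 hZ,
    z.1, MonoOp.fst_mem_primalSolutions hz, z.2, MonoOp.snd_mem_dualSolutions hz,
    tendsto_toWeakSpace_of_inner hx, tendsto_toWeakSpace_of_inner hv, hz⟩
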